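/- Let $k$ be a field, $d \ge 0$ an integer, $E = \mathbb{R}^d$ with the Euclidean norm, and $p \in [1,\infty]$. Let $X \subseteq E$ be a subset and $f \colon X \to [0,\infty)$ an arbitrary function. For $x \in X$ and $t \ge 0$ put $$r_x(t) = \begin{cases} -\infty & \text{if } t < f(x),\\ (t^p - f(x)^p)^{1/p} & \text{if } t \ge f(x) \text{ and } p < \infty,\\ t & \text{if } t \ge f(x) \text{ and } p = \infty,\end{cases}$$ and let $V^t[X,f] = \bigcup_{x \in X} \overline{B}(x, r_x(t))$ be the union of the closed Euclidean balls with these radii, where a ball of radius $-\infty$ is empty. The sets $V^t[X,f]$ increase with $t$. For an integer $n \ge 0$ let $\mathbb{V}_n[X,f]$ be the persistence module over $[0,\infty)$ formed by the singular homology spaces $H_n(V^t[X,f]; k)$, $t \ge 0$, and the linear maps $v_s^t \colon H_n(V^s[X,f];k) \to H_n(V^t[X,f];k)$, $s \le t$, induced by the inclusions. 1. If $X$ is finite, then for every $n \ge 0$ the module $\mathbb{V}_n[X,f]$ is pointwise finite-dimensional: $H_n(V^t[X,f];k)$ is finite-dimensional for every $t \ge 0$. 2. If $X$ is bounded, then for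 every $n \ge 0$ the module $\mathbb{V}_n[X,f]$ is $q$-tame: for all $0 \le s < t$ the map $v_s^t$ has finite rank. -/

import Mathlib

open scoped NNReal ENNReal
open CategoryTheory

universe u

noncomputable section

/-- A persistence module over `ℝ≥0` with coefficients in `k`: `k`-vector spaces `M.obj t` and
linear maps `M.map : M.obj s ⟶ M.obj t` for `s ≤ t`, compatible with identities and composition,
that is, a functor on the ordered set `ℝ≥0`. -/
abbrev PersistenceModule (k : Type u) [Field k] := ℝ≥0 ⥤ ModuleCat.{u} k

namespace PersistenceModule

variable {k : Type u} [Field k]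

/-- Every vector space of the persistence module has finite dimension. -/
def IsPointwiseFiniteDimensional (M : PersistenceModule k) : Prop :=
  ∀ t : ℝ≥0, FiniteDimensional k (M.obj t)

/-- For all `s < t` the structure map from `s` to `t` has finite rank. -/
def IsQTame (M : PersistenceModule k) : Prop :=
  ∀ (s t : ℝ≥0) (h : s < t),
    FiniteDimensional k (LinearMap.range (M.map (homOfLE h.le)).hom)

end PersistenceModule

/-- A non-decreasing family of subsets of a topological space, as a functor to topological spaces:
the subsets carry the subspace topology and the maps are the inclusions. -/
def filtrationFunctor {E : Type*} [TopologicalSpace E] (V : ℝ≥0 → Set E) (hV : Monotone V) :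
    ℝ≥0 ⥤ TopCat where
  obj t := TopCat.of (V t)
  map h := TopCat.ofHom ⟨Set.inclusion (hV (leOfHom h)), continuous_inclusion (hV (leOfHom h))⟩

/-- The persistent homology of a filtration of a topological space: degree `n` singular homology
with coefficients in the field `k`. -/
def persistentHomology {E : Type} [TopologicalSpace E] (k : Type u) [Field k] (n : ℕ)
    (V : ℝ≥0 → Set E) (hV : Monotone V) : PersistenceModule k :=
  filtrationFunctor V hV ⋙
    (AlgebraicTopology.singularHomologyFunctor (ModuleCat.{u} k) n).obj (ModuleCat.of k k)

namespace WeightedCech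

/-- The radius at time `t` of the ball around a point of weight `w`; `⊥` stands for `-∞`.
It is `(t ^ p - w ^ p) ^ (1 / p)` for `w ≤ t` (and `t` if `p = ∞`). In the last branch one has
`w ≤ t`, so the subtraction in `ℝ≥0` is not truncated. -/
def radius (p : ℝ≥0∞) (w t : ℝ≥0) : WithBot ℝ≥0 :=
  if t < w then ⊥
  else if p = ∞ then (t : WithBot ℝ≥0)
  else (((t ^ p.toReal - w ^ p.toReal) ^ (1 / p.toReal) : ℝ≥0) : WithBot ℝ≥0)

/-- The closed ball of centre `x` and radius `r ∈ [0, ∞) ∪ {-∞}`; it is empty for `r = -∞`. -/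
def ball {E : Type*} [PseudoMetricSpace E] (x : E) (r : WithBot ℝ≥0) : Set E :=
  {y | (nndist y x : WithBot ℝ≥0) ≤ r}

/-- The member at time `t` of the weighted Čech filtration with parameters `(X, f, p)`. -/
def sublevel {E : Type*} [PseudoMetricSpace E] (p : ℝ≥0∞) (X : Set E) (f : X → ℝ≥0)
    (t : ℝ≥0) : Set E :=
  ⋃ x : X, ball (x : E) (radius p (f x) t)

theorem radius_mono (p : ℝ≥0∞) (w : ℝ≥0) : Monotone (radius p w) := by
  intro s t h
  unfold radius
  by_cases hs : s < w
  · simp [hs]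
  · have ht : ¬ t < w := fun h' => hs (h.trans_lt h')
    by_cases hp : p = ∞
    · simpa [hs, ht, hp] using h
    · simp only [hs, ht, hp, if_false]
      exact WithBot.coe_le_coe.2 (NNReal.rpow_le_rpow (tsub_le_tsub_right
        (NNReal.rpow_le_rpow h ENNReal.toReal_nonneg) _) (by positivity))

theorem sublevel_mono {E : Type*} [PseudoMetricSpace E] (p : ℝ≥0∞) (X : Set E) (f : X → ℝ≥0) :
    Monotone (sublevel p X f) := fun _ _ h =>
  Set.iUnion_mono fun x _ hy => le_trans hy (radius_mono p (f x) h)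

/-- The degree `n` persistent homology module, over the field `k`, of the weighted Čech filtration
with parameters `(X, f, p)`. -/
def persistence {E : Type} [PseudoMetricSpace E] (k : Type u) [Field k] (n : ℕ) (p : ℝ≥0∞)
    (X : Set E) (f : X → ℝ≥0) : PersistenceModule k :=
  persistentHomology k n (sublevel p X f) (sublevel_mono p X f)

end WeightedCech

end

/-!
Both claims follow from one finiteness statement: if `A` is a totally bounded subset of a normed
space and `B` contains its closed `δ`-neighbourhood for some `δ > 0`, then the inclusion of `A` into
`B` has finite rank on singular homology
(`finiteDimensional_range_homologyMap_inclusion`). To see this, let `P` be a finite `δ / 2`-net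
of `A`. Moving the vertices of a singular simplex of `A` of diameter at most `δ / 2` to nearby
points of `P` gives a tuple of points of `P`, whose affine simplex lies in `B` and is joined to the given
simplex by segments in `B`. These segments form a simplicial homotopy
(`nonempty_homotopy_of_segment_subset`), so on the subcomplex of small singular simplices the
inclusion factors, up to homotopy, through a simplicial set with finitely many simplices in each
degree. The choice of the nearby points need not be continuous. Finally, the small simplices carry
all of the homology of `A` (`singular.homologyMap_small_surjective`): a cycle is homologous to its
iterated barycentric subdivisions. Only this surjectivity is needed, and no excision.

For the subdivision, chains of tuples of points of a standard simplex are subdivided by coning off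
from barycentres (`tupleSSet.sd`), and the result is carried to singular chains along the affine
simplices on the tuples (`singular.transfer`).

If `X` is bounded, Minkowski's inequality for the `p`-norm on the plane shows that the closed
`(t - s)`-neighbourhood of the sublevel set at time `s` lies in the one at time `t`
(`WeightedCech.mem_sublevel_of_dist_le`), which gives `q`-tameness.

If `X` is finite, the sublevel set is a finite union `K` of compact convex sets. Such a union has a
neighbourhood with a continuous map to `K` whose restriction to `K` is homotopic to the identity
(`exists_neighborhood_map_of_iUnion_convex`). Hence the identity of the homology of `K`
factors through the map induced by the inclusion of `K` into a neighbourhood, which has finite rank.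
-/

/-! ### Chains of simplicial sets -/

noncomputable section

open Simplicial Limits

namespace SSet

variable {k : Type u} [Field k] {X Y : SSet.{0}} {n : ℕ}

variable (k X n) in
/-- The vector space of simplicial `n`-chains of `X` with coefficients in `k`. -/
abbrev chains : ModuleCat.{u} k := (X.chainComplex (ModuleCat.of k k)).X n

variable (k X n) in
/-- The boundary operator on simplicial chains. -/
abbrev chainBoundary : chains k X (n + 1) →ₗ[k] chains k X n :=
  ((X.chainComplex (ModuleCat.of k k)).d (n + 1) n).hom

variable (k n) in
/-- The map on simplicial chains induced by a map of simplicial sets. -/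
abbrev pushforward (f : X ⟶ Y) : chains k X n →ₗ[k] chains k Y n :=
  ((chainComplexMap f (ModuleCat.of k k)).f n).hom

variable (k) in
/-- The chain given by a single simplex. -/
def single (x : X _⦋n⦌) : chains k X n :=
  (X.ιChainComplex (R := ModuleCat.of k k) x).hom (1 : k)

theorem chain_hom_ext {M : Type u} [AddCommGroup M] [Module k M]
    {f g : chains k X n →ₗ[k] M}
    (h : ∀ x : X _⦋n⦌, f (single k x) = g (single k x)) : f = g := by
  have : ModuleCat.ofHom f = ModuleCat.ofHom g := by
    refine chainComplex_hom_ext fun x => ?_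
    ext
    exact h x
  exact congrArg ModuleCat.Hom.hom this

/-- The linear map on chains with prescribed values on the simplices. -/
def chainLift {M : ModuleCat.{u} k} (f : X _⦋n⦌ → M) :
    chains k X n →ₗ[k] M :=
  (Cofan.IsColimit.desc (X.isColimitChainComplexXCofan (ModuleCat.of k k) n)
    fun x => ModuleCat.ofHom (LinearMap.toSpanSingleton k M (f x))).hom

@[simp]
theorem chainLift_single {M : ModuleCat.{u} k} (f : X _⦋n⦌ → M) (x : X _⦋n⦌) :
    chainLift f (single k x) = f x :=
  (congrArg (fun φ : ModuleCat.of k k ⟶ M => φ.hom (1 : k))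
    (Cofan.IsColimit.fac (X.isColimitChainComplexXCofan (ModuleCat.of k k) n)
      (fun x => ModuleCat.ofHom (LinearMap.toSpanSingleton k M (f x))) x)).trans (one_smul k (f x))

theorem boundary_single (x : X _⦋n + 1⦌) :
    chainBoundary k X n (single k x) =
      ∑ i : Fin (n + 2), (-1 : ℤ) ^ (i : ℕ) • single k (X.δ i x) := by
  refine (congrArg (fun φ : ModuleCat.of k k ⟶ _ => φ.hom (1 : k))
    (X.ιChainComplex_d (R := ModuleCat.of k k) x)).trans ?_
  simp [single, ModuleCat.hom_sum, LinearMap.sum_apply]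

theorem pushforward_single (f : X ⟶ Y) (x : X _⦋n⦌) :
    pushforward k n f (single k x) = single k (f.app _ x) :=
  congrArg (fun φ : ModuleCat.of k k ⟶ _ => φ.hom (1 : k))
    (ι_chainComplexMap_f X Y f (ModuleCat.of k k) x)

variable (k X n) in
theorem span_range_single :
    Submodule.span k (Set.range (single k : X _⦋n⦌ → _)) = ⊤ := by
  rw [← Submodule.ker_mkQ (Submodule.span k (Set.range (single k : X _⦋n⦌ → _))),
    LinearMap.ker_eq_top]
  refine chain_hom_ext fun x => ?_
  simpa using Submodule.subset_span (Set.mem_range_self x)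

theorem boundary_boundary (c : chains k X (n + 2)) :
    chainBoundary k X n (chainBoundary k X (n + 1) c) = 0 :=
  congrArg (fun f : chains k X (n + 2) ⟶ chains k X n => f.hom c)
    ((X.chainComplex (ModuleCat.of k k)).d_comp_d (n + 2) (n + 1) n)

theorem boundary_pushforward (f : X ⟶ Y) (c : chains k X (n + 1)) :
    chainBoundary k Y n (pushforward k (n + 1) f c) = pushforward k n f (chainBoundary k X n c) :=
  congrArg (fun f : chains k X (n + 1) ⟶ chains k Y n => f.hom c)
    ((chainComplexMap f (ModuleCat.of k k)).comm (n + 1) n)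

end SSet

/-- The simplicial set whose `n`-simplices are all `(n + 1)`-tuples of elements of `D`. -/
def tupleSSet (D : Type) : SSet.{0} where
  obj n := Fin (n.unop.len + 1) → D
  map α := ↾fun x => x ∘ α.unop.toOrderHom

namespace tupleSSet

open SSet (chains chainBoundary pushforward)

variable {D : Type}

/-- The simplicial map induced by a map of vertices. -/
def map {D' : Type} (g : D → D') : tupleSSet D ⟶ tupleSSet D' where
  app n := ↾fun x => g ∘ x

variable {k : Type u} [Field k] {n : ℕ}

variable (k) in
/-- The chain given by a single tuple. -/
def single (x : Fin (n + 1) → D) : chains k (tupleSSet D) n :=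
  SSet.single k (X := tupleSSet D) (n := n) x

theorem chain_hom_ext {M : Type u} [AddCommGroup M] [Module k M]
    {f g : chains k (tupleSSet D) n →ₗ[k] M}
    (h : ∀ x : Fin (n + 1) → D, f (single k x) = g (single k x)) : f = g :=
  SSet.chain_hom_ext h

/-- The linear map on chains with prescribed values on the tuples. -/
def chainLift {M : ModuleCat.{u} k} (f : (Fin (n + 1) → D) → M) :
    chains k (tupleSSet D) n →ₗ[k] M :=
  SSet.chainLift (X := tupleSSet D) (n := n) f

@[simp]
theorem chainLift_single {M : ModuleCat.{u} k} (f : (Fin (n + 1) → D) → M)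
    (x : Fin (n + 1) → D) : chainLift f (single k x) = f x :=
  SSet.chainLift_single (X := tupleSSet D) (n := n) f x

theorem boundary_single (x : Fin (n + 2) → D) :
    chainBoundary k (tupleSSet D) n (single k x) =
      ∑ i : Fin (n + 2), (-1 : ℤ) ^ (i : ℕ) • single k (x ∘ i.succAbove) :=
  SSet.boundary_single _

theorem pushforward_single {D' : Type} (g : D → D') (x : Fin (n + 1) → D) :
    pushforward k n (map g) (single k x) = single k (g ∘ x) :=
  SSet.pushforward_single _ _

end tupleSSet

open HomologicalComplex in
/-- If every cycle of `L` is homologous to the image of a cycle of `K`, then `K ⟶ L` is surjective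
on homology. -/
theorem homologyMap_surjective_of_cycles {k : Type u} [Field k]
    {K L : ChainComplex (ModuleCat.{u} k) ℕ} (φ : K ⟶ L) (n : ℕ)
    (h : ∀ z : L.X n, (∀ j, (L.d n j).hom z = 0) →
      ∃ y : K.X n, (∀ j, (K.d n j).hom y = 0) ∧
        ∃ w : L.X (n + 1), z = (φ.f n).hom y + (L.d (n + 1) n).hom w) :
    Function.Surjective (homologyMap φ n).hom := by
  intro x
  obtain ⟨c, rfl⟩ := (ModuleCat.epi_iff_surjective (L.homologyπ n)).1 inferInstance x
  obtain ⟨y, hy, w, hw⟩ := h ((L.iCycles n).hom c) fun j =>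
    congrArg (fun f : L.cycles n ⟶ L.X j => f.hom c) (L.iCycles_d n j)
  let γ : ModuleCat.of k k ⟶ K.X n := ModuleCat.ofHom (LinearMap.toSpanSingleton k _ y)
  have hγ : γ ≫ K.d n ((ComplexShape.down ℕ).next n) = 0 := by
    ext
    simpa [γ] using hy _
  let ω : ModuleCat.of k k ⟶ L.X (n + 1) := ModuleCat.ofHom (LinearMap.toSpanSingleton k _ w)
  let κ : ModuleCat.of k k ⟶ L.cycles n := ModuleCat.ofHom (LinearMap.toSpanSingleton k _ c)
  have hκ {Z : ModuleCat k} (g : L.cycles n ⟶ Z) : (κ ≫ g).hom (1 : k) = g.hom c :=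
    congrArg g.hom (one_smul k c)
  have key : κ = K.liftCycles γ _ rfl hγ ≫ cyclesMap φ n + ω ≫ L.toCycles (n + 1) n := by
    rw [← cancel_mono (L.iCycles n)]
    ext
    rw [hκ]
    simpa [γ, ω] using hw
  have key' : κ ≫ L.homologyπ n = (K.liftCycles γ _ rfl hγ ≫ K.homologyπ n) ≫ homologyMap φ n := by
    rw [key]
    simp
  refine ⟨(K.liftCycles γ _ rfl hγ ≫ K.homologyπ n).hom (1 : k), ?_⟩
  have := congrArg (fun f : ModuleCat.of k k ⟶ _ => f.hom (1 : k)) key'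
  exact this.symm.trans (hκ _)

theorem finiteDimensional_homology {k : Type u} [Field k] (K : ChainComplex (ModuleCat.{u} k) ℕ)
    (n : ℕ) (h : FiniteDimensional k (K.X n)) : FiniteDimensional k (K.homology n) := by
  have h1 : FiniteDimensional k (K.cycles n) :=
    FiniteDimensional.of_injective (K.iCycles n).hom
      ((ModuleCat.mono_iff_injective (K.iCycles n)).1 inferInstance)
  exact Module.Finite.of_surjective (K.homologyπ n).hom
    ((ModuleCat.epi_iff_surjective (K.homologyπ n)).1 inferInstance)

theorem SSet.finiteDimensional_homology_of_finite (k : Type u) [Field k] (X : SSet.{0}) (n : ℕ)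
    (h : Finite (X _⦋n⦌)) :
    FiniteDimensional k (SSet.homology X (ModuleCat.of k k) n : ModuleCat.{u} k) :=
  finiteDimensional_homology _ _
    ⟨⟨(Set.finite_range (SSet.single k : X _⦋n⦌ → _)).toFinset, by
      simpa using SSet.span_range_single k X n⟩⟩

end

/-! ### Barycentric subdivision of chains of tuples -/

noncomputable section

namespace tupleSSet

open SSet (chains chainBoundary pushforward boundary_boundary boundary_pushforward)

variable {k : Type u} [Field k] {D D' : Type} {n : ℕ}

variable (k n) in
/-- The cone operator with apex `a`: it prepends the vertex `a` to a tuple. -/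
def cone (a : D) : chains k (tupleSSet D) n →ₗ[k] chains k (tupleSSet D) (n + 1) :=
  chainLift fun x : Fin (n + 1) → D =>
    single k (Fin.cons a x : Fin (n + 2) → D)

theorem cone_single (a : D) (x : Fin (n + 1) → D) :
    cone k n a (single k x) =
      single k (Fin.cons a x : Fin (n + 2) → D) :=
  chainLift_single _ _

theorem cons_comp_succ_succAbove (a : D) (x : Fin (n + 2) → D) (i : Fin (n + 2)) :
    (Fin.cons a x : Fin (n + 3) → D) ∘ i.succ.succAbove = Fin.cons a (x ∘ i.succAbove) := by
  funext j
  refine Fin.cases ?_ (fun j => ?_) j <;> simp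

/-- The cone operator is a contracting homotopy in positive degrees. -/
theorem boundary_cone (a : D) (c : chains k (tupleSSet D) (n + 1)) :
    chainBoundary k (tupleSSet D) (n + 1) (cone k (n + 1) a c) =
      c - cone k n a (chainBoundary k (tupleSSet D) n c) := by
  suffices h : chainBoundary k (tupleSSet D) (n + 1) ∘ₗ cone k (n + 1) a =
      LinearMap.id - cone k n a ∘ₗ chainBoundary k (tupleSSet D) n from LinearMap.congr_fun h c
  refine chain_hom_ext fun x => ?_
  simp only [LinearMap.comp_apply, LinearMap.sub_apply, LinearMap.id_apply]
  rw [cone_single, boundary_single, boundary_single, Fin.sum_univ_succ, map_sum]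
  simp only [map_zsmul, cone_single, cons_comp_succ_succAbove]
  simp only [Fin.val_succ, pow_succ, mul_neg, mul_one, neg_smul, Finset.sum_neg_distrib,
    sub_eq_add_neg]
  congr 1
  simp

/-- In degree `0` the formula for the boundary of a cone has an additional multiple of the apex,
which vanishes on boundaries. -/
theorem boundary_cone_boundary (a : D) (c : chains k (tupleSSet D) 1) :
    chainBoundary k (tupleSSet D) 0 (cone k 0 a (chainBoundary k (tupleSSet D) 0 c)) =
      chainBoundary k (tupleSSet D) 0 c := by
  suffices h : chainBoundary k (tupleSSet D) 0 ∘ₗ cone k 0 a ∘ₗ chainBoundary k (tupleSSet D) 0 =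
      chainBoundary k (tupleSSet D) 0 from LinearMap.congr_fun h c
  refine chain_hom_ext fun x => ?_
  have h (y : Fin 1 → D) : chainBoundary k (tupleSSet D) 0 (cone k 0 a
      (single k y)) =
      single k y -
        single k (fun _ : Fin 1 => a) := by
    rw [cone_single, boundary_single]
    have h1 : (Fin.cons a y : Fin 2 → D) ∘ Fin.succAbove 1 = fun _ => a := by
      funext i
      fin_cases i
      rfl
    simp [h1, sub_eq_add_neg]
  simp only [LinearMap.comp_apply]
  rw [boundary_single]
  simp [h, sub_eq_add_neg]

theorem pushforward_cone (g : D → D') (a : D) (c : chains k (tupleSSet D) n) :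
    pushforward k (n + 1) (map g) (cone k n a c) = cone k n (g a) (pushforward k n (map g) c) := by
  suffices h : pushforward k (n + 1) (map g) ∘ₗ cone k n a =
      cone k n (g a) ∘ₗ pushforward k n (map g) from LinearMap.congr_fun h c
  refine chain_hom_ext fun x => ?_
  simp only [LinearMap.comp_apply]
  rw [cone_single, pushforward_single, pushforward_single, cone_single]
  congr 1
  exact Fin.comp_cons g a x

/-- Barycentric subdivision of chains of tuples, where `b` assigns a barycentre to each tuple:
a tuple is sent to the cone, from its barycentre, over the subdivision of its boundary. -/
def sd (k : Type u) [Field k] (b : ∀ n, (Fin (n + 1) → D) → D) :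
    ∀ n, chains k (tupleSSet D) n →ₗ[k] chains k (tupleSSet D) n
  | 0 => LinearMap.id
  | n + 1 => chainLift fun x : Fin (n + 2) → D =>
      cone k n (b (n + 1) x) (sd k b n (chainBoundary k (tupleSSet D) n
        (single k x)))

/-- The chain homotopy from the identity to barycentric subdivision. -/
def sdHomotopy (k : Type u) [Field k] (b : ∀ n, (Fin (n + 1) → D) → D) :
    ∀ n, chains k (tupleSSet D) n →ₗ[k] chains k (tupleSSet D) (n + 1)
  | 0 => 0
  | n + 1 => chainLift fun x : Fin (n + 2) → D =>
      cone k (n + 1) (b (n + 1) x) (single k x -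
        sdHomotopy k b n (chainBoundary k (tupleSSet D) n
          (single k x)))

variable (b : ∀ n, (Fin (n + 1) → D) → D) (b' : ∀ n, (Fin (n + 1) → D') → D')

theorem sd_single (x : Fin (n + 2) → D) :
    sd k b (n + 1) (single k x) =
      cone k n (b (n + 1) x) (sd k b n (chainBoundary k (tupleSSet D) n
        (single k x))) :=
  chainLift_single _ _

theorem sdHomotopy_single (x : Fin (n + 2) → D) :
    sdHomotopy k b (n + 1) (single k x) =
      cone k (n + 1) (b (n + 1) x) (single k x -
        sdHomotopy k b n (chainBoundary k (tupleSSet D) n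
          (single k x))) :=
  chainLift_single _ _

theorem boundary_sd (c : chains k (tupleSSet D) (n + 1)) :
    chainBoundary k (tupleSSet D) n (sd k b (n + 1) c) =
      sd k b n (chainBoundary k (tupleSSet D) n c) := by
  induction n with
  | zero =>
    suffices h : chainBoundary k (tupleSSet D) 0 ∘ₗ sd k b 1 =
        sd k b 0 ∘ₗ chainBoundary k (tupleSSet D) 0 from LinearMap.congr_fun h c
    refine chain_hom_ext fun x => ?_
    simp only [LinearMap.comp_apply]
    rw [sd_single]
    exact boundary_cone_boundary _ _
  | succ n ih =>
    suffices h : chainBoundary k (tupleSSet D) (n + 1) ∘ₗ sd k b (n + 2) =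
        sd k b (n + 1) ∘ₗ chainBoundary k (tupleSSet D) (n + 1) from LinearMap.congr_fun h c
    refine chain_hom_ext fun x => ?_
    simp only [LinearMap.comp_apply]
    rw [sd_single, boundary_cone, ih, boundary_boundary]
    simp

theorem boundary_sdHomotopy (c : chains k (tupleSSet D) (n + 1)) :
    chainBoundary k (tupleSSet D) (n + 1) (sdHomotopy k b (n + 1) c) +
      sdHomotopy k b n (chainBoundary k (tupleSSet D) n c) = c - sd k b (n + 1) c := by
  induction n with
  | zero =>
    suffices h : chainBoundary k (tupleSSet D) 1 ∘ₗ sdHomotopy k b 1 +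
        sdHomotopy k b 0 ∘ₗ chainBoundary k (tupleSSet D) 0 = LinearMap.id - sd k b 1 from
      LinearMap.congr_fun h c
    refine chain_hom_ext fun x => ?_
    simp only [LinearMap.comp_apply, LinearMap.add_apply, LinearMap.sub_apply, LinearMap.id_apply]
    rw [sd_single, sdHomotopy_single, boundary_cone]
    simp [sdHomotopy, sd]
  | succ n ih =>
    suffices h : chainBoundary k (tupleSSet D) (n + 2) ∘ₗ sdHomotopy k b (n + 2) +
        sdHomotopy k b (n + 1) ∘ₗ chainBoundary k (tupleSSet D) (n + 1) =
          LinearMap.id - sd k b (n + 2) from LinearMap.congr_fun h c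
    refine chain_hom_ext fun x => ?_
    simp only [LinearMap.comp_apply, LinearMap.add_apply, LinearMap.sub_apply, LinearMap.id_apply]
    have := ih (chainBoundary k (tupleSSet D) (n + 1)
      (single k x))
    rw [boundary_boundary, map_zero, add_zero] at this
    rw [sd_single, sdHomotopy_single, boundary_cone, map_sub, this, sub_sub_cancel]
    abel

variable {b b'} in
theorem pushforward_sd (g : D → D') (hg : ∀ n x, g (b n x) = b' n (g ∘ x))
    (c : chains k (tupleSSet D) n) :
    pushforward k n (map g) (sd k b n c) = sd k b' n (pushforward k n (map g) c) := by
  induction n with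
  | zero => rfl
  | succ n ih =>
    suffices h : pushforward k (n + 1) (map g) ∘ₗ sd k b (n + 1) =
        sd k b' (n + 1) ∘ₗ pushforward k (n + 1) (map g) from LinearMap.congr_fun h c
    refine chain_hom_ext fun x => ?_
    simp only [LinearMap.comp_apply]
    rw [sd_single, pushforward_cone, ih, ← boundary_pushforward, pushforward_single,
      sd_single, hg]

variable {b b'} in
theorem pushforward_sdHomotopy (g : D → D') (hg : ∀ n x, g (b n x) = b' n (g ∘ x))
    (c : chains k (tupleSSet D) n) :
    pushforward k (n + 1) (map g) (sdHomotopy k b n c) =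
      sdHomotopy k b' n (pushforward k n (map g) c) := by
  induction n with
  | zero => simp [sdHomotopy]
  | succ n ih =>
    suffices h : pushforward k (n + 2) (map g) ∘ₗ sdHomotopy k b (n + 1) =
        sdHomotopy k b' (n + 1) ∘ₗ pushforward k (n + 1) (map g) from LinearMap.congr_fun h c
    refine chain_hom_ext fun x => ?_
    simp only [LinearMap.comp_apply]
    rw [sdHomotopy_single, pushforward_cone, map_sub, ih, ← boundary_pushforward,
      pushforward_single, sdHomotopy_single, hg]

/-! ### The mesh of a barycentric subdivision -/

/-- The tuples whose vertices are pairwise at distance at most `r`. -/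
def diamLE (D : Type) [PseudoMetricSpace D] (n : ℕ) (r : ℝ) : Set (Fin (n + 1) → D) :=
  {x | ∀ i j, dist (x i) (x j) ≤ r}

variable [PseudoMetricSpace D]

variable {b} in
/-- Besides the bound on the diameters, the induction needs that the vertices of the subdivision
lie in the convex hull of the vertices of the tuple. The second condition expresses this through
balls: every closed ball that contains the tuple contains the subdivision. -/
theorem sd_single_mem_span
    (hb : ∀ n (x : Fin (n + 1) → D) p r, (∀ i, dist p (x i) ≤ r) → dist p (b n x) ≤ r)
    (hb' : ∀ n (x : Fin (n + 1) → D) r, (∀ i j, dist (x i) (x j) ≤ r) →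
      ∀ i, dist (b n x) (x i) ≤ n / (n + 1) * r)
    (x : Fin (n + 1) → D) (r : ℝ) (hx : ∀ i j, dist (x i) (x j) ≤ r) :
    sd k b n (single k x) ∈
      Submodule.span k (single k '' (diamLE D n (n / (n + 1) * r) ∩
        {y | ∀ p s, (∀ i, dist p (x i) ≤ s) → ∀ j, dist p (y j) ≤ s})) := by
  have hr : 0 ≤ r := dist_nonneg.trans (hx 0 0)
  induction n with
  | zero =>
    refine Submodule.subset_span ⟨x, ⟨fun i j => ?_, fun p s h => h⟩, rfl⟩
    rw [Subsingleton.elim (α := Fin 1) i j]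
    simp
  | succ n ih =>
    rw [sd_single, boundary_single]
    simp only [map_sum, map_zsmul]
    refine Submodule.sum_mem _ fun i _ => zsmul_mem ?_ _
    have h1 := ih (x ∘ i.succAbove) (fun _ _ => hx _ _)
    rw [← Submodule.mem_comap]
    refine Submodule.span_le.2 ?_ h1
    rintro _ ⟨y, ⟨hy, hy'⟩, rfl⟩
    rw [SetLike.mem_coe, Submodule.mem_comap]
    rw [cone_single]
    have key (j) : dist (b (n + 1) x) (y j) ≤ (n + 1 : ℕ) / ((n + 1 : ℕ) + 1) * r :=
      hy' _ _ (fun l => hb' _ x r hx _) j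
    have hfrac : (n / (n + 1) * r : ℝ) ≤ (n + 1 : ℕ) / ((n + 1 : ℕ) + 1) * r := by
      refine mul_le_mul_of_nonneg_right ?_ hr
      rw [div_le_div_iff₀ (by positivity) (by positivity)]
      push_cast
      nlinarith
    refine Submodule.subset_span ⟨_, ⟨fun j l => ?_, fun p s h j => ?_⟩, rfl⟩
    · refine Fin.cases ?_ (fun j => ?_) j <;> refine Fin.cases ?_ (fun l => ?_) l
      · simpa using by positivity
      · simpa using key l
      · simpa [dist_comm] using key j
      · simpa using (hy j l).trans hfrac
    · refine Fin.cases ?_ (fun j => ?_) j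
      · simpa using hb _ x p s h
      · simpa using hy' p s (fun l => h _) j

variable {b} in
theorem sd_iterate_mem_span
    (hb : ∀ n (x : Fin (n + 1) → D) p r, (∀ i, dist p (x i) ≤ r) → dist p (b n x) ≤ r)
    (hb' : ∀ n (x : Fin (n + 1) → D) r, (∀ i j, dist (x i) (x j) ≤ r) →
      ∀ i, dist (b n x) (x i) ≤ n / (n + 1) * r)
    (x : Fin (n + 1) → D) (r : ℝ) (hx : x ∈ diamLE D n r) (j : ℕ) :
    (sd k b n)^[j] (single k x) ∈
      Submodule.span k (single k '' (diamLE D n ((n / (n + 1)) ^ j * r))) := by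
  induction j with
  | zero => exact Submodule.subset_span ⟨x, by simpa using hx, rfl⟩
  | succ j ih =>
    rw [Function.iterate_succ_apply', ← Submodule.mem_comap]
    refine Submodule.span_le.2 ?_ ih
    rintro _ ⟨y, hy, rfl⟩
    refine Submodule.span_mono (Set.image_mono ?_) (sd_single_mem_span hb hb' y _ hy)
    rw [pow_succ', mul_assoc]
    exact Set.inter_subset_left

end tupleSSet
end

noncomputable section

open Opposite SSet

/-! ### Affine simplices -/

section Affine

variable {ι κ E : Type*} [Fintype ι] [Fintype κ]

/-- The point with barycentric coordinates `t` with respect to the points `y i`. -/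
def affinePoint [AddCommGroup E] [Module ℝ E] (y : ι → E) (t : stdSimplex ℝ ι) : E :=
  ∑ i, t i • y i

theorem affinePoint_map [AddCommGroup E] [Module ℝ E] (y : κ → E) (f : ι → κ)
    (t : stdSimplex ℝ ι) : affinePoint y (stdSimplex.map f t) = affinePoint (y ∘ f) t := by
  classical
  simp only [affinePoint, stdSimplex.map_coe, FunOnFinite.linearMap_apply_apply, Finset.sum_smul]
  rw [← Finset.sum_fiberwise Finset.univ f]
  refine Finset.sum_congr rfl fun j _ => Finset.sum_congr rfl fun i hi => ?_
  rw [Function.comp_apply, (Finset.mem_filter.1 hi).2]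

theorem affinePoint_mem [AddCommGroup E] [Module ℝ E] {s : Set E} (hs : Convex ℝ s) {y : ι → E}
    (hy : ∀ i, y i ∈ s) (t : stdSimplex ℝ ι) : affinePoint y t ∈ s :=
  hs.sum_mem (fun i _ => t.2.1 i) t.2.2 fun i _ => hy i

theorem affinePoint_vertex [DecidableEq ι] [AddCommGroup E] [Module ℝ E] (y : ι → E) (i : ι) :
    affinePoint y (stdSimplex.vertex i) = y i := by
  simp [affinePoint, Pi.single_apply]

theorem continuous_affinePoint [AddCommGroup E] [Module ℝ E] [TopologicalSpace E]
    [ContinuousAdd E] [ContinuousSMul ℝ E] (y : ι → E) : Continuous (affinePoint y) := by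
  refine continuous_finsetSum _ fun i _ => ?_
  exact ((continuous_apply i).comp continuous_subtype_val).smul continuous_const

theorem dist_affinePoint_le [SeminormedAddCommGroup E] [NormedSpace ℝ E] {y : ι → E} {p : E}
    {r : ℝ} (h : ∀ i, dist p (y i) ≤ r) (t : stdSimplex ℝ ι) : dist p (affinePoint y t) ≤ r := by
  have := affinePoint_mem (convex_closedBall p r)
    (fun i => Metric.mem_closedBall'.2 (h i)) t
  exact Metric.mem_closedBall'.1 this

theorem dist_affinePoint_barycenter_le [SeminormedAddCommGroup E] [NormedSpace ℝ E] {n : ℕ}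
    {y : Fin (n + 1) → E} {r : ℝ} (h : ∀ i j, dist (y i) (y j) ≤ r) (i : Fin (n + 1)) :
    dist (affinePoint y stdSimplex.barycenter) (y i) ≤ n / (n + 1) * r := by
  have h1 : affinePoint y stdSimplex.barycenter - y i =
      ∑ j ∈ Finset.univ.erase i, ((n : ℝ) + 1)⁻¹ • (y j - y i) := by
    have : ∑ j ∈ Finset.univ.erase i, ((n : ℝ) + 1)⁻¹ • (y j - y i) =
        ∑ j, ((n : ℝ) + 1)⁻¹ • (y j - y i) := Finset.sum_erase _ (by simp)
    rw [this]
    simp only [smul_sub, Finset.sum_sub_distrib, Finset.sum_const, Finset.card_univ,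
      Fintype.card_fin]
    congr 1
    · refine Finset.sum_congr rfl fun j _ => ?_
      congr 1
      simp [stdSimplex.barycenter, DFunLike.coe]
    · rw [← Nat.cast_smul_eq_nsmul ℝ, smul_smul]
      push_cast
      rw [mul_inv_cancel₀ (by positivity), one_smul]
  rw [dist_eq_norm, h1]
  refine (norm_sum_le _ _).trans ?_
  calc ∑ j ∈ Finset.univ.erase i, ‖((n : ℝ) + 1)⁻¹ • (y j - y i)‖
      ≤ ∑ j ∈ Finset.univ.erase i, ((n : ℝ) + 1)⁻¹ * r := by
        refine Finset.sum_le_sum fun j _ => ?_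
        rw [norm_smul, Real.norm_of_nonneg (by positivity), ← dist_eq_norm]
        exact mul_le_mul_of_nonneg_left (h j i) (by positivity)
    _ = n / (n + 1) * r := by
        simp [Finset.card_erase_of_mem, div_eq_mul_inv, mul_assoc]

theorem affinePoint_affinePoint [AddCommGroup E] [Module ℝ E] (y : κ → E)
    (w : ι → stdSimplex ℝ κ) (t : stdSimplex ℝ ι) (q : stdSimplex ℝ κ)
    (hq : (q : κ → ℝ) = affinePoint (fun i => (w i : κ → ℝ)) t) :
    affinePoint y q = affinePoint (fun i => affinePoint y (w i)) t := by
  have (j : κ) : q j = ∑ i, t i * w i j := by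
    have := congrFun hq j
    simpa [affinePoint] using this
  simp only [affinePoint, this, Finset.sum_smul, Finset.smul_sum, smul_smul]
  exact Finset.sum_comm

end Affine

/-- The affine map of standard simplices that is given by the images of the vertices. -/
def affineSimplexMap {n m : ℕ} (y : Fin (m + 1) → stdSimplex ℝ (Fin (n + 1))) :
    C(stdSimplex ℝ (Fin (m + 1)), stdSimplex ℝ (Fin (n + 1))) where
  toFun t := ⟨affinePoint (fun i => (y i : Fin (n + 1) → ℝ)) t,
    affinePoint_mem (convex_stdSimplex ℝ _) (fun i => (y i).2) t⟩
  continuous_toFun := (continuous_affinePoint _).subtype_mk _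

theorem affineSimplexMap_comp {n m l : ℕ} (y : Fin (m + 1) → stdSimplex ℝ (Fin (n + 1)))
    (w : Fin (l + 1) → stdSimplex ℝ (Fin (m + 1))) (t : stdSimplex ℝ (Fin (l + 1))) :
    affineSimplexMap y (affineSimplexMap w t) = affineSimplexMap (affineSimplexMap y ∘ w) t :=
  Subtype.ext (affinePoint_affinePoint _ w t _ rfl)

theorem affineSimplexMap_vertex {n m : ℕ} (y : Fin (m + 1) → stdSimplex ℝ (Fin (n + 1)))
    (i : Fin (m + 1)) : affineSimplexMap y (stdSimplex.vertex i) = y i :=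
  Subtype.ext (affinePoint_vertex _ i)

theorem affineSimplexMap_vertices {n : ℕ} :
    affineSimplexMap (stdSimplex.vertex : Fin (n + 1) → _) = ContinuousMap.id _ := by
  refine ContinuousMap.ext fun t => Subtype.ext (funext fun i => ?_)
  change (∑ j, t j • (Pi.single j 1 : Fin (n + 1) → ℝ)) i = t i
  simp [Finset.sum_apply, Pi.single_apply]

theorem affineSimplexMap_map {n m l : ℕ} (y : Fin (m + 1) → stdSimplex ℝ (Fin (n + 1)))
    (f : Fin (l + 1) → Fin (m + 1)) (t : stdSimplex ℝ (Fin (l + 1))) :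
    affineSimplexMap y (stdSimplex.map f t) = affineSimplexMap (y ∘ f) t :=
  Subtype.ext (affinePoint_map _ f t)

/-- The barycentre of a tuple of points of a standard simplex. -/
def tupleBarycenter (N n : ℕ) (y : Fin (n + 1) → stdSimplex ℝ (Fin (N + 1))) :
    stdSimplex ℝ (Fin (N + 1)) :=
  affineSimplexMap y stdSimplex.barycenter

/-! ### Subdivision of singular chains -/

namespace singular

variable {X : TopCat.{0}} {k : Type u} [Field k] {n m : ℕ}

/-- The map from tuples of points of the standard simplex to singular simplices of `X` that
composes the affine simplex on a tuple with a fixed singular simplex `σ`. -/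
def ofTuples (σ : C(stdSimplex ℝ (Fin (n + 1)), X)) :
    tupleSSet (stdSimplex ℝ (Fin (n + 1))) ⟶ TopCat.toSSet.obj X where
  app m := ↾fun y : Fin (m.unop.len + 1) → _ =>
    (TopCat.toSSetObjEquiv X m).symm (σ.comp (affineSimplexMap y))
  naturality m l α := by
    ext y
    refine (TopCat.toSSetObjEquiv X l).injective (ContinuousMap.ext fun t => ?_)
    change Fin (m.unop.len + 1) → _ at y
    exact congrArg σ (affineSimplexMap_map y α.unop.toOrderHom t).symm

/-- The singular simplex given by a continuous map, as a chain. -/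
def single (k : Type u) [Field k] (σ : C(stdSimplex ℝ (Fin (n + 1)), X)) :
    chains k (TopCat.toSSet.obj X) n :=
  SSet.single k ((TopCat.toSSetObjEquiv X (op (SimplexCategory.mk n))).symm σ)

theorem chain_hom_ext {M : Type u} [AddCommGroup M] [Module k M]
    {f g : chains k (TopCat.toSSet.obj X) n →ₗ[k] M}
    (h : ∀ σ : C(stdSimplex ℝ (Fin (n + 1)), X), f (single k σ) = g (single k σ)) : f = g :=
  SSet.chain_hom_ext fun x => by
    simpa [single] using h (TopCat.toSSetObjEquiv X (op (SimplexCategory.mk n)) x)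

theorem pushforward_ofTuples_single (σ : C(stdSimplex ℝ (Fin (n + 1)), X))
    (y : Fin (m + 1) → stdSimplex ℝ (Fin (n + 1))) :
    pushforward k m (ofTuples σ) (tupleSSet.single k y) = single k (σ.comp (affineSimplexMap y)) :=
  SSet.pushforward_single _ _

theorem map_comp_ofTuples (σ : C(stdSimplex ℝ (Fin (n + 1)), X))
    (y : Fin (m + 1) → stdSimplex ℝ (Fin (n + 1))) :
    tupleSSet.map (affineSimplexMap y) ≫ ofTuples σ = ofTuples (σ.comp (affineSimplexMap y)) := by
  ext l w
  refine (TopCat.toSSetObjEquiv X l).injective (ContinuousMap.ext fun t => ?_)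
  change Fin (l.unop.len + 1) → _ at w
  exact congrArg σ (affineSimplexMap_comp y w t).symm

theorem pushforward_comp {X Y Z : SSet.{0}} (f : X ⟶ Y) (g : Y ⟶ Z) (c : chains k X n) :
    pushforward k n (f ≫ g) c = pushforward k n g (pushforward k n f c) := by
  have h : chainComplexMap (f ≫ g) (ModuleCat.of k k) =
      chainComplexMap f (ModuleCat.of k k) ≫ chainComplexMap g (ModuleCat.of k k) :=
    Functor.map_comp _ _ _
  exact congrArg (fun φ => (φ.f n).hom c) h

/-- The operator on singular chains of `X` induced by an operator `φ` on chains of tuples: its value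
on a singular simplex is the image of the value of `φ` on the tuple of vertices. -/
def transfer (X : TopCat.{0})
    (φ : ∀ N : ℕ, chains k (tupleSSet (stdSimplex ℝ (Fin (N + 1)))) n →ₗ[k]
      chains k (tupleSSet (stdSimplex ℝ (Fin (N + 1)))) m) :
    chains k (TopCat.toSSet.obj X) n →ₗ[k] chains k (TopCat.toSSet.obj X) m :=
  SSet.chainLift fun σ =>
    pushforward k m (ofTuples (TopCat.toSSetObjEquiv X (op (SimplexCategory.mk n)) σ))
      (φ n (tupleSSet.single k stdSimplex.vertex))

/-- A natural operator on chains of tuples commutes with the passage to singular chains. -/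
theorem transfer_pushforward
    {φ : ∀ N : ℕ, chains k (tupleSSet (stdSimplex ℝ (Fin (N + 1)))) n →ₗ[k]
      chains k (tupleSSet (stdSimplex ℝ (Fin (N + 1)))) m}
    (hφ : ∀ N M (y : Fin (M + 1) → stdSimplex ℝ (Fin (N + 1))) c,
      pushforward k m (tupleSSet.map (affineSimplexMap y)) (φ M c) =
        φ N (pushforward k n (tupleSSet.map (affineSimplexMap y)) c))
    {N : ℕ} (σ : C(stdSimplex ℝ (Fin (N + 1)), X))
    (c : chains k (tupleSSet (stdSimplex ℝ (Fin (N + 1)))) n) :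
    transfer X φ (pushforward k n (ofTuples σ) c) = pushforward k m (ofTuples σ) (φ N c) := by
  suffices h : transfer X φ ∘ₗ pushforward k n (ofTuples σ) =
      pushforward k m (ofTuples σ) ∘ₗ φ N from LinearMap.congr_fun h c
  refine tupleSSet.chain_hom_ext fun y => ?_
  simp only [LinearMap.comp_apply]
  rw [pushforward_ofTuples_single, transfer, single, SSet.chainLift_single,
    Equiv.apply_symm_apply, ← map_comp_ofTuples, pushforward_comp, hφ,
    tupleSSet.pushforward_single]
  exact congrArg (fun w => pushforward k m (ofTuples σ) (φ N (tupleSSet.single k w)))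
    (funext (affineSimplexMap_vertex y))

/-- A singular simplex is the image of the tuple of vertices of the standard simplex. By this lemma,
identities between natural operators need to be checked on chains of tuples only. -/
theorem single_eq_pushforward (σ : C(stdSimplex ℝ (Fin (n + 1)), X)) :
    single k σ = pushforward k n (ofTuples σ) (tupleSSet.single k stdSimplex.vertex) := by
  rw [pushforward_ofTuples_single, affineSimplexMap_vertices, ContinuousMap.comp_id]

theorem affineSimplexMap_tupleBarycenter {N M : ℕ} (y : Fin (M + 1) → stdSimplex ℝ (Fin (N + 1)))
    (n : ℕ) (x : Fin (n + 1) → stdSimplex ℝ (Fin (M + 1))) :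
    affineSimplexMap y (tupleBarycenter M n x) = tupleBarycenter N n (affineSimplexMap y ∘ x) :=
  affineSimplexMap_comp _ _ _

variable (k X n) in
/-- Barycentric subdivision of singular chains. -/
def sd : chains k (TopCat.toSSet.obj X) n →ₗ[k] chains k (TopCat.toSSet.obj X) n :=
  transfer X fun N => tupleSSet.sd k (tupleBarycenter N) n

variable (k X n) in
/-- The chain homotopy from the identity to barycentric subdivision of singular chains. -/
def sdHomotopy : chains k (TopCat.toSSet.obj X) n →ₗ[k] chains k (TopCat.toSSet.obj X) (n + 1) :=
  transfer X fun N => tupleSSet.sdHomotopy k (tupleBarycenter N) n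

theorem sd_pushforward {N : ℕ} (σ : C(stdSimplex ℝ (Fin (N + 1)), X))
    (c : chains k (tupleSSet (stdSimplex ℝ (Fin (N + 1)))) n) :
    sd X k n (pushforward k n (ofTuples σ) c) =
      pushforward k n (ofTuples σ) (tupleSSet.sd k (tupleBarycenter N) n c) :=
  transfer_pushforward (fun _ _ y c =>
    tupleSSet.pushforward_sd _ (affineSimplexMap_tupleBarycenter y) c) σ c

theorem sdHomotopy_pushforward {N : ℕ} (σ : C(stdSimplex ℝ (Fin (N + 1)), X))
    (c : chains k (tupleSSet (stdSimplex ℝ (Fin (N + 1)))) n) :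
    sdHomotopy X k n (pushforward k n (ofTuples σ) c) =
      pushforward k (n + 1) (ofTuples σ) (tupleSSet.sdHomotopy k (tupleBarycenter N) n c) :=
  transfer_pushforward (fun _ _ y c =>
    tupleSSet.pushforward_sdHomotopy _ (affineSimplexMap_tupleBarycenter y) c) σ c

theorem boundary_sd (c : chains k (TopCat.toSSet.obj X) (n + 1)) :
    chainBoundary k _ n (sd X k (n + 1) c) = sd X k n (chainBoundary k _ n c) := by
  suffices h : chainBoundary k _ n ∘ₗ sd X k (n + 1) = sd X k n ∘ₗ chainBoundary k _ n from
    LinearMap.congr_fun h c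
  refine chain_hom_ext fun σ => ?_
  simp only [LinearMap.comp_apply]
  rw [single_eq_pushforward, sd_pushforward, boundary_pushforward, boundary_pushforward,
    sd_pushforward, tupleSSet.boundary_sd]

theorem boundary_sdHomotopy (c : chains k (TopCat.toSSet.obj X) (n + 1)) :
    chainBoundary k _ (n + 1) (sdHomotopy X k (n + 1) c) +
      sdHomotopy X k n (chainBoundary k _ n c) = c - sd X k (n + 1) c := by
  suffices h : chainBoundary k _ (n + 1) ∘ₗ sdHomotopy X k (n + 1) +
      sdHomotopy X k n ∘ₗ chainBoundary k _ n = LinearMap.id - sd X k (n + 1) from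
    LinearMap.congr_fun h c
  refine chain_hom_ext fun σ => ?_
  simp only [LinearMap.comp_apply, LinearMap.add_apply, LinearMap.sub_apply, LinearMap.id_apply]
  rw [single_eq_pushforward, sd_pushforward, sdHomotopy_pushforward, boundary_pushforward,
    boundary_pushforward, sdHomotopy_pushforward, ← map_add, ← map_sub,
    tupleSSet.boundary_sdHomotopy]

theorem sd_zero (c : chains k (TopCat.toSSet.obj X) 0) : sd X k 0 c = c := by
  suffices h : sd X k 0 = LinearMap.id from LinearMap.congr_fun h c
  refine chain_hom_ext fun σ => ?_
  rw [single_eq_pushforward, sd_pushforward]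
  rfl

end singular
end

noncomputable section

open Opposite SSet

/-! ### Small singular simplices -/

namespace SSet

theorem pushforward_injective {k : Type u} [Field k] {X Y : SSet.{0}} (n : ℕ) (f : X ⟶ Y)
    (hf : Function.Injective (f.app (op (SimplexCategory.mk n)))) :
    Function.Injective (pushforward k n f) := by
  classical
  -- A retraction on chains sends the simplices outside the image to zero.
  let g : chains k Y n →ₗ[k] chains k X n := chainLift fun y =>
    if h : ∃ x, f.app (op (SimplexCategory.mk n)) x = y then single k h.choose else 0
  have hg : g ∘ₗ pushforward k n f = LinearMap.id := by
    refine chain_hom_ext fun x => ?_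
    have hx : ∃ x', f.app (op (SimplexCategory.mk n)) x' =
      f.app (op (SimplexCategory.mk n)) x := ⟨x, rfl⟩
    rw [LinearMap.comp_apply, pushforward_single, chainLift_single, dif_pos hx, hf hx.choose_spec]
    rfl
  exact Function.LeftInverse.injective (LinearMap.congr_fun hg)

end SSet

namespace singular

variable {k : Type u} [Field k] {n : ℕ} (A : Type) [PseudoMetricSpace A]

/-- The subcomplex of the singular simplices whose images have diameter at most `η`. -/
def small (η : ℝ) : (TopCat.toSSet.obj (TopCat.of A)).Subcomplex where
  obj n := {σ | ∀ s t, dist (α := A) (TopCat.toSSetObjEquiv (TopCat.of A) n σ s)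
    (TopCat.toSSetObjEquiv (TopCat.of A) n σ t) ≤ η}
  map α _ hσ s t := hσ (stdSimplex.map α.unop.toOrderHom s) (stdSimplex.map α.unop.toOrderHom t)

variable {A}

/-- The simplices of an iterated subdivision of `σ` are the composites of `σ` with affine simplices
of small diameter, and `σ` is uniformly continuous. -/
theorem sd_iterate_single_mem_span (σ : C(stdSimplex ℝ (Fin (n + 1)), TopCat.of A)) {η : ℝ}
    (hη : 0 < η) : ∀ᶠ j in Filter.atTop, (sd (TopCat.of A) k n)^[j] (single k σ) ∈
      Submodule.span k (SSet.single k '' (small A η).obj (op (SimplexCategory.mk n))) := by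
  have hσ : UniformContinuous (β := A) σ :=
    CompactSpace.uniformContinuous_of_continuous (β := A) σ.continuous
  obtain ⟨δ, hδ, hσδ⟩ := Metric.uniformContinuous_iff.1 hσ η hη
  have hlim : Filter.Tendsto (fun j : ℕ => ((n : ℝ) / (n + 1)) ^ j * 1) Filter.atTop
      (nhds (0 * 1)) := by
    refine (tendsto_pow_atTop_nhds_zero_of_lt_one (by positivity) ?_).mul_const 1
    rw [div_lt_one (by positivity)]
    linarith
  rw [zero_mul] at hlim
  filter_upwards [hlim.eventually (gt_mem_nhds hδ)] with j hj
  have h1 := tupleSSet.sd_iterate_mem_span (k := k) (D := stdSimplex ℝ (Fin (n + 1)))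
    (b := tupleBarycenter n)
    (fun m x p r h => dist_affinePoint_le (E := Fin (n + 1) → ℝ) (p := p)
      (y := fun i => (x i : Fin (n + 1) → ℝ)) h stdSimplex.barycenter)
    (fun m x r h => dist_affinePoint_barycenter_le (E := Fin (n + 1) → ℝ)
      (y := fun i => (x i : Fin (n + 1) → ℝ)) h)
    stdSimplex.vertex 1 (fun i j => by
      refine (Metric.dist_le_diam_of_mem (bounded_stdSimplex (Fin (n + 1)))
        (stdSimplex.vertex i).2 (stdSimplex.vertex j).2).trans ?_
      exact diam_stdSimplex_le) j
  have h2 : (sd (TopCat.of A) k n)^[j] (single k σ) = pushforward k n (ofTuples σ)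
      ((tupleSSet.sd k (tupleBarycenter n) n)^[j] (tupleSSet.single k stdSimplex.vertex)) := by
    rw [single_eq_pushforward]
    exact (Function.Semiconj.iterate_right (fun c => (sd_pushforward σ c).symm) j _).symm
  rw [h2, ← Submodule.mem_comap]
  refine Submodule.span_le.2 ?_ h1
  rintro _ ⟨y, hy, rfl⟩
  rw [SetLike.mem_coe, Submodule.mem_comap, pushforward_ofTuples_single]
  refine Submodule.subset_span ⟨_, fun s t => ?_, rfl⟩
  rw [Equiv.apply_symm_apply]
  refine (hσδ (lt_of_le_of_lt ?_ hj)).le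
  refine dist_affinePoint_le (E := Fin (n + 1) → ℝ) (fun i => ?_) t
  rw [dist_comm]
  refine dist_affinePoint_le (E := Fin (n + 1) → ℝ) (fun l => ?_) s
  exact hy i l

theorem sd_iterate_mem_span (c : chains k (TopCat.toSSet.obj (TopCat.of A)) n) {η : ℝ}
    (hη : 0 < η) : ∀ᶠ j in Filter.atTop, (sd (TopCat.of A) k n)^[j] c ∈
      Submodule.span k (SSet.single k '' (small A η).obj (op (SimplexCategory.mk n))) := by
  have hc : c ∈ Submodule.span k (Set.range (SSet.single k)) := by
    rw [SSet.span_range_single]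
    trivial
  induction hc using Submodule.span_induction with
  | mem c hc =>
    obtain ⟨σ, rfl⟩ := hc
    simpa [single] using sd_iterate_single_mem_span (k := k)
      (TopCat.toSSetObjEquiv (TopCat.of A) (op (SimplexCategory.mk n)) σ) hη
  | zero => simp [iterate_map_zero]
  | add x y _ _ hx hy =>
    filter_upwards [hx, hy] with j h1 h2
    rw [iterate_map_add]
    exact add_mem h1 h2
  | smul a x _ hx =>
    filter_upwards [hx] with j h
    rw [← Module.End.coe_pow] at h ⊢
    rw [map_smul]
    exact Submodule.smul_mem _ a h

/-- A cycle is homologous to its iterated subdivisions. -/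
theorem exists_sub_sd_iterate_eq_boundary {X : TopCat.{0}} (c : chains k (TopCat.toSSet.obj X) n)
    (hc : ∀ j, ((chainComplex (TopCat.toSSet.obj X) (ModuleCat.of k k)).d n j).hom c = 0) (j : ℕ) :
    (∀ i, ((chainComplex (TopCat.toSSet.obj X) (ModuleCat.of k k)).d n i).hom
      ((sd X k n)^[j] c) = 0) ∧
    ∃ w, c = (sd X k n)^[j] c + chainBoundary k (TopCat.toSSet.obj X) n w := by
  induction j with
  | zero => exact ⟨hc, 0, by simp⟩
  | succ j ih =>
    obtain ⟨h1, w, hw⟩ := ih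
    rw [Function.iterate_succ_apply']
    set c' := (sd X k n)^[j] c
    cases n with
    | zero =>
      rw [sd_zero]
      exact ⟨h1, w, hw⟩
    | succ n =>
      have h0 : chainBoundary k (TopCat.toSSet.obj X) n c' = 0 := h1 n
      refine ⟨fun i => ?_, w + sdHomotopy X k (n + 1) c', ?_⟩
      · by_cases hi : i = n
        · subst hi
          refine (boundary_sd c').trans ?_
          rw [h0, map_zero]
        · rw [HomologicalComplex.shape _ _ _ fun h => hi (Nat.succ_injective h)]
          rfl
      · have := boundary_sdHomotopy c'
        rw [h0, map_zero, add_zero] at this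
        rw [map_add, this]
        refine hw.trans ?_
        abel

/-- Small singular simplices suffice to represent every homology class. -/
theorem homologyMap_small_surjective {η : ℝ} (hη : 0 < η) (n : ℕ) :
    Function.Surjective
      (SSet.homologyMap (small A η).ι (ModuleCat.of k k) n).hom := by
  refine homologyMap_surjective_of_cycles _ n fun z hz => ?_
  obtain ⟨j, hj⟩ := (sd_iterate_mem_span z hη).exists
  obtain ⟨h1, w, hw⟩ := exists_sub_sd_iterate_eq_boundary z hz j
  have h2 : Submodule.span k (SSet.single k '' (small A η).obj (op (SimplexCategory.mk n))) ≤
      LinearMap.range (pushforward k n (small A η).ι) := by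
    refine Submodule.span_le.2 ?_
    rintro _ ⟨σ, hσ, rfl⟩
    exact ⟨SSet.single k (X := (small A η).toSSet) ⟨σ, hσ⟩, pushforward_single _ _⟩
  obtain ⟨y, hy⟩ := h2 hj
  refine ⟨y, fun i => ?_, w, ?_⟩
  · refine pushforward_injective i (small A η).ι Subtype.val_injective ?_
    rw [map_zero, ← h1 i, ← hy]
    exact congrArg (fun φ => φ.hom y)
      ((chainComplexMap (small A η).ι (ModuleCat.of k k)).comm n i).symm
  · exact hw.trans (by rw [← hy])

end singular
end

noncomputable section

open Opposite SSet

/-! ### Straight-line homotopies -/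

/-- The homotopy parameter: the second barycentric coordinate of the image of `t` under a
simplex `θ` of the simplicial interval. -/
def intervalCoord {m : SimplexCategoryᵒᵖ}
    (θ : (SSet.stdSimplex.{0}.obj (SimplexCategory.mk 1)).obj m)
    (t : stdSimplex ℝ (Fin (m.unop.len + 1))) : ℝ :=
  affinePoint (fun i => (((SSet.stdSimplex.objEquiv θ).toOrderHom i : ℕ) : ℝ)) t

theorem intervalCoord_mem {m : SimplexCategoryᵒᵖ}
    (θ : (SSet.stdSimplex.{0}.obj (SimplexCategory.mk 1)).obj m)
    (t : stdSimplex ℝ (Fin (m.unop.len + 1))) : intervalCoord θ t ∈ Set.Icc (0 : ℝ) 1 :=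
  affinePoint_mem (convex_Icc 0 1) (fun i => ⟨Nat.cast_nonneg _, by
    have : ((SSet.stdSimplex.objEquiv θ).toOrderHom i : ℕ) ≤ 1 := Nat.le_of_lt_succ (Fin.is_lt _)
    exact_mod_cast this⟩) t

open MonoidalCategory in
/-- Two maps into the singular simplicial set of a subset `B` of a vector space are homotopic if
the segments between corresponding points of corresponding simplices lie in `B`. -/
theorem nonempty_homotopy_of_segment_subset {E : Type} [AddCommGroup E] [Module ℝ E]
    [TopologicalSpace E] [ContinuousAdd E] [ContinuousSMul ℝ E] {S : SSet.{0}} {B : Set E}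
    (f g : S ⟶ TopCat.toSSet.obj (TopCat.of B))
    (h : ∀ m (σ : S.obj m) t, segment ℝ (TopCat.toSSetObjEquiv (TopCat.of B) m (f.app m σ) t : E)
      (TopCat.toSSetObjEquiv (TopCat.of B) m (g.app m σ) t : E) ⊆ B) :
    Nonempty (SSet.Homotopy f g) := by
  have hmem (m : SimplexCategoryᵒᵖ) (σ : S.obj m)
      (θ : (SSet.stdSimplex.{0}.obj (SimplexCategory.mk 1)).obj m)
      (t : stdSimplex ℝ (Fin (m.unop.len + 1))) :
      (1 - intervalCoord θ t) • (TopCat.toSSetObjEquiv (TopCat.of B) m (f.app m σ) t : E) +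
        intervalCoord θ t • (TopCat.toSSetObjEquiv (TopCat.of B) m (g.app m σ) t : E) ∈ B := by
    obtain ⟨h0, h1⟩ := intervalCoord_mem θ t
    exact h m σ t ⟨_, _, sub_nonneg.2 h1, h0, by ring, rfl⟩
  -- On a simplex `σ` paired with `θ`, the homotopy is `(1 - c) • f σ + c • g σ`, where `c`
  -- is the coordinate of `θ`.
  let H : S ⊗ SSet.stdSimplex.obj (SimplexCategory.mk 1) ⟶ TopCat.toSSet.obj (TopCat.of B) :=
    { app := fun m => ↾fun x => (TopCat.toSSetObjEquiv (TopCat.of B) m).symm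
        ⟨fun t => ⟨_, hmem m x.1 x.2 t⟩, by
          refine Continuous.subtype_mk ?_ _
          have h1 : Continuous (intervalCoord x.2) := continuous_affinePoint _
          have h2 (σ) : Continuous fun t =>
              (TopCat.toSSetObjEquiv (TopCat.of B) m σ t : E) :=
            continuous_subtype_val.comp (TopCat.toSSetObjEquiv (TopCat.of B) m σ).continuous
          exact ((continuous_const.sub h1).smul (h2 _)).add (h1.smul (h2 _))⟩
      naturality := fun m l α => by
        ext x
        refine (TopCat.toSSetObjEquiv (TopCat.of B) l).injective
          (ContinuousMap.ext fun t => Subtype.ext ?_)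
        have hθ : intervalCoord ((SSet.stdSimplex.obj (SimplexCategory.mk 1)).map α x.2) t =
            intervalCoord x.2 (stdSimplex.map α.unop.toOrderHom t) :=
          (affinePoint_map (fun i => (((SSet.stdSimplex.objEquiv x.2).toOrderHom i : ℕ) : ℝ))
            α.unop.toOrderHom t).symm
        have hn (φ : S ⟶ TopCat.toSSet.obj (TopCat.of B)) :
            TopCat.toSSetObjEquiv (TopCat.of B) l (φ.app l (S.map α x.1)) t =
              TopCat.toSSetObjEquiv (TopCat.of B) m (φ.app m x.1)
                (stdSimplex.map α.unop.toOrderHom t) := by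
          rw [NatTrans.naturality_apply]
          rfl
        change (1 - intervalCoord ((SSet.stdSimplex.obj (SimplexCategory.mk 1)).map α x.2) t) •
            (TopCat.toSSetObjEquiv (TopCat.of B) l (f.app l (S.map α x.1)) t : E) +
          intervalCoord ((SSet.stdSimplex.obj (SimplexCategory.mk 1)).map α x.2) t •
            (TopCat.toSSetObjEquiv (TopCat.of B) l (g.app l (S.map α x.1)) t : E) = _
        rw [hθ, hn, hn]
        rfl }
  have hconst (c : ℕ) (m : SimplexCategoryᵒᵖ) (θ) (t : stdSimplex ℝ (Fin (m.unop.len + 1)))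
      (hθ : ∀ i, ((SSet.stdSimplex.objEquiv θ).toOrderHom i : ℕ) = c) :
      intervalCoord θ t = c := by
    simp only [intervalCoord, hθ, affinePoint, ← Finset.sum_smul]
    rw [stdSimplex.sum_eq_one, one_smul]
  refine ⟨{ h := H, h₀ := ?_, h₁ := ?_, rel := ?_ }⟩
  · ext m σ
    refine (TopCat.toSSetObjEquiv (TopCat.of B) m).injective
      (ContinuousMap.ext fun t => Subtype.ext ?_)
    have h0 := hconst 0 m (ι₀.app m σ).2 t (fun i => rfl)
    change (1 - intervalCoord (ι₀.app m σ).2 t) • _ + intervalCoord (ι₀.app m σ).2 t • _ = _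
    rw [h0]
    simp
    rfl
  · ext m σ
    refine (TopCat.toSSetObjEquiv (TopCat.of B) m).injective
      (ContinuousMap.ext fun t => Subtype.ext ?_)
    have h0 := hconst 1 m (ι₁.app m σ).2 t (fun i => rfl)
    change (1 - intervalCoord (ι₁.app m σ).2 t) • _ + intervalCoord (ι₁.app m σ).2 t • _ = _
    rw [h0]
    simp
    rfl
  · ext _ ⟨⟨_, ⟨⟩⟩, _⟩

/-! ### Finite rank of inclusions into a neighbourhood -/

/-- The inclusion of a subset into a larger one, as a morphism of topological spaces. -/
def inclusionHom {E : Type} [TopologicalSpace E] {A B : Set E} (h : A ⊆ B) :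
    TopCat.of A ⟶ TopCat.of B :=
  TopCat.ofHom ⟨Set.inclusion h, continuous_inclusion h⟩

/-- The tuples of elements of `P` whose affine simplex lies in `B`. -/
def affineTuples {E : Type} [AddCommGroup E] [Module ℝ E] (P B : Set E) :
    (tupleSSet P).Subcomplex where
  obj m := {y : Fin (m.unop.len + 1) → P | ∀ t, affinePoint (fun i => (y i : E)) t ∈ B}
  map α y hy t := by
    change Fin _ → P at y
    have := hy (stdSimplex.map α.unop.toOrderHom t)
    rwa [affinePoint_map] at this

/-- The simplicial map that sends a tuple to its affine singular simplex in `B`. -/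
def affineTuplesRealization {E : Type} [AddCommGroup E] [Module ℝ E] [TopologicalSpace E]
    [ContinuousAdd E] [ContinuousSMul ℝ E] (P B : Set E) :
    (affineTuples P B).toSSet ⟶ TopCat.toSSet.obj (TopCat.of B) where
  app m := ↾fun y => (TopCat.toSSetObjEquiv (TopCat.of B) m).symm
    ⟨fun t => ⟨_, y.2 t⟩, (continuous_affinePoint _).subtype_mk _⟩
  naturality m l α := by
    ext y
    refine (TopCat.toSSetObjEquiv (TopCat.of B) l).injective
      (ContinuousMap.ext fun t => Subtype.ext ?_)
    exact (affinePoint_map (fun i => ((y.1 : Fin (m.unop.len + 1) → P) i : E))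
      α.unop.toOrderHom t).symm

theorem finiteDimensional_range_of_comp {k : Type u} [Field k] {S K L F : ModuleCat.{u} k}
    (j : S ⟶ K) (i : K ⟶ L) (r : S ⟶ F) (a : F ⟶ L)
    (hj : Function.Surjective j.hom) (hF : FiniteDimensional k F) (h : j ≫ i = r ≫ a) :
    FiniteDimensional k (LinearMap.range i.hom) := by
  have h1 : LinearMap.range i.hom ≤ LinearMap.range a.hom := by
    rintro _ ⟨x, rfl⟩
    obtain ⟨y, rfl⟩ := hj x
    exact ⟨r.hom y, (congrArg (fun φ => φ.hom y) h).symm⟩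
  have : FiniteDimensional k (LinearMap.range a.hom) := inferInstance
  exact Submodule.finiteDimensional_of_le h1

/-- If `B` contains a neighbourhood of positive radius of the totally bounded set `A`, then the
inclusion of `A` into `B` has finite rank on singular homology. -/
theorem finiteDimensional_range_homologyMap_inclusion {E : Type} [NormedAddCommGroup E]
    [NormedSpace ℝ E] (k : Type u) [Field k] (n : ℕ) {A B : Set E} (hA : TotallyBounded A) {δ : ℝ}
    (hδ : 0 < δ) (hAB : ∀ a ∈ A, ∀ x, dist a x ≤ δ → x ∈ B) (h : A ⊆ B) :
    FiniteDimensional k (LinearMap.range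
      (SSet.homologyMap (TopCat.toSSet.map (inclusionHom h)) (ModuleCat.of k k) n).hom) := by
  obtain ⟨P, hPA, hP, hcov⟩ := Metric.finite_approx_of_totallyBounded hA (δ / 2) (half_pos hδ)
  have hnear (a : A) : ∃ p : P, dist (a : E) p < δ / 2 := by
    have := hcov a.2
    simp only [Set.mem_iUnion, Metric.mem_ball] at this
    obtain ⟨p, hp, hd⟩ := this
    exact ⟨⟨p, hp⟩, hd⟩
  choose π hπ using hnear
  -- The affine simplex on approximations of the vertices of a small simplex stays close to it.
  have hdist (m : SimplexCategoryᵒᵖ) (σ : (singular.small A (δ / 2)).toSSet.obj m) (s t) :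
      dist (TopCat.toSSetObjEquiv (TopCat.of A) m σ.1 s : E) (affinePoint (fun i =>
        (π (TopCat.toSSetObjEquiv (TopCat.of A) m σ.1 (stdSimplex.vertex i)) : E)) t) ≤ δ := by
    refine dist_affinePoint_le (fun i => ?_) t
    refine (dist_triangle _ _ _).trans ((add_le_add (σ.2 s (stdSimplex.vertex i))
      (hπ _).le).trans (add_halves δ).le)
  let r : (singular.small A (δ / 2)).toSSet ⟶ (affineTuples P B).toSSet :=
    { app := fun m => ↾fun σ => ⟨fun i =>
        π (TopCat.toSSetObjEquiv (TopCat.of A) m σ.1 (stdSimplex.vertex i)), fun t =>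
          hAB _ (TopCat.toSSetObjEquiv (TopCat.of A) m σ.1 t).2 _ (hdist m σ t t)⟩
      naturality := fun m l α => by
        ext σ
        refine Subtype.ext (funext fun i => congrArg π ?_)
        refine congrArg (TopCat.toSSetObjEquiv (TopCat.of A) m σ.1) ?_
        exact stdSimplex.map_vertex _ _ }
  obtain ⟨H⟩ := nonempty_homotopy_of_segment_subset
    ((singular.small A (δ / 2)).ι ≫ TopCat.toSSet.map (inclusionHom h))
    (r ≫ affineTuplesRealization P B) (fun m σ t => by
      set a : A := TopCat.toSSetObjEquiv (TopCat.of A) m σ.1 t with ha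
      have h1 : segment ℝ (a : E) (affinePoint (fun i =>
          (π (TopCat.toSSetObjEquiv (TopCat.of A) m σ.1 (stdSimplex.vertex i)) : E)) t) ⊆
            Metric.closedBall (a : E) δ :=
        (convex_closedBall _ _).segment_subset (Metric.mem_closedBall_self hδ.le)
          (Metric.mem_closedBall'.2 (hdist m σ t t))
      exact h1.trans fun x hx => hAB a a.2 x (Metric.mem_closedBall'.1 hx))
  have key := H.congr_homologyMap (ModuleCat.of k k) n
  rw [SSet.homologyMap_comp, SSet.homologyMap_comp] at key
  refine finiteDimensional_range_of_comp _ _ _ _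
    (singular.homologyMap_small_surjective (half_pos hδ) n) ?_ key
  refine SSet.finiteDimensional_homology_of_finite k _ n ?_
  have : Finite P := hP
  have : Finite (Fin (n + 1) → P) := inferInstance
  exact Finite.of_injective (β := Fin (n + 1) → P) _ Subtype.val_injective

end

noncomputable section

open Opposite SSet

/-! ### Finite unions of compact convex sets -/

section ConvexUnion

variable {E : Type} [NormedAddCommGroup E] [NormedSpace ℝ E] {ι : Type*} [Finite ι]

open Topology Filter Metric in
/-- By compactness, if the `ε`-neighbourhoods of finitely many compact sets have a common point for
arbitrarily small `ε`, then so do the sets themselves. -/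
theorem eventually_iInter_nonempty_of_infDist_lt {E : Type*} [MetricSpace E] {ι : Type*}
    {C : ι → Set E} (hC : ∀ i, IsCompact (C i)) (hne : ∀ i, (C i).Nonempty) (σ : Finset ι)
    (hσ : σ.Nonempty) :
    ∀ᶠ ε : ℝ in 𝓝[>] 0, (∃ y, ∀ i ∈ σ, infDist y (C i) < ε) → ∃ z, ∀ i ∈ σ, z ∈ C i := by
  by_cases h : ∃ z, ∀ i ∈ σ, z ∈ C i
  · exact Eventually.of_forall fun _ _ => h
  obtain ⟨i₀, hi₀⟩ := hσ
  have hcont : Continuous fun z => ∑ i ∈ σ, infDist z (C i) :=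
    continuous_finsetSum _ fun i _ => continuous_infDist_pt _
  -- On `C i₀` the sum of the distances has a positive minimum, while at a point of `C i₀` that is
  -- `ε`-close to `y` it is at most `2 * ε` times the number of sets.
  obtain ⟨z₀, hz₀, hmin⟩ := (hC i₀).exists_isMinOn (hne i₀) hcont.continuousOn
  have hpos : 0 < ∑ i ∈ σ, infDist z₀ (C i) := by
    refine (Finset.sum_nonneg fun i _ => infDist_nonneg).lt_of_ne fun h0 => h ⟨z₀, fun i hi => ?_⟩
    have := (Finset.sum_eq_zero_iff_of_nonneg fun i _ => infDist_nonneg).1 h0.symm i hi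
    exact (hC i).isClosed.mem_iff_infDist_zero (hne i) |>.2 this
  have hlim : Tendsto (fun ε : ℝ => ∑ _i ∈ σ, (ε + ε)) (𝓝[>] 0) (𝓝 0) := by
    have : Continuous fun ε : ℝ => ∑ _i ∈ σ, (ε + ε) := by fun_prop
    simpa using (this.tendsto 0).mono_left nhdsWithin_le_nhds
  filter_upwards [hlim.eventually (gt_mem_nhds hpos)] with ε hε
  rintro ⟨y, hy⟩
  obtain ⟨z, hz, hyz⟩ := (infDist_lt_iff (hne i₀)).1 (hy i₀ hi₀)
  refine absurd ?_ (isMinOn_iff.1 hmin z hz).not_gt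
  refine lt_of_le_of_lt (Finset.sum_le_sum fun i hi => ?_) hε
  calc infDist z (C i) ≤ infDist y (C i) + dist z y := infDist_le_infDist_add_dist
    _ ≤ ε + ε := add_le_add (hy i hi).le (by rw [dist_comm]; exact hyz.le)

open Topology Filter Metric in
/-- A finite union of compact convex sets has a neighbourhood `B` with a continuous map to the
union, whose restriction to the union moves every point along a segment in the union.

If the sets are `C i`, let `lam i y` measure how far `y` is inside the `ε`-neighbourhood of `C i`.
The map sends `y` to a convex combination of points `p σ`, chosen in the intersections of the
`C i`, `i ∈ σ`, with a positive weight exactly when the functions `lam i`, `i ∈ σ`, are positive at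
`y` and exceed the other ones. (These `σ` are the vertices of the simplex that contains the image of
`y` in the barycentric subdivision of the nerve.) If `lam j y` is maximal, then all such `σ`
contain `j`, so that the value lies in `C j`. A point of `C j` has maximal `lam j`, so it moves inside `C j`. -/
theorem exists_neighborhood_map_of_iUnion_convex {C : ι → Set E} (hC : ∀ i, IsCompact (C i))
    (hconv : ∀ i, Convex ℝ (C i)) (hne : ∀ i, (C i).Nonempty) :
    ∃ δ > 0, ∃ B : Set E, (∀ a ∈ ⋃ i, C i, ∀ x, dist a x ≤ δ → x ∈ B) ∧
      ∃ f : C(B, ⋃ i, C i), ∀ y : B, (y : E) ∈ ⋃ i, C i →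
        segment ℝ (y : E) (f y) ⊆ ⋃ i, C i := by
  classical
  have := Fintype.ofFinite ι
  obtain ⟨ε, hε, hε0⟩ := ((eventually_all.2 fun σ : {σ : Finset ι // σ.Nonempty} =>
    eventually_iInter_nonempty_of_infDist_lt hC hne σ.1 σ.2).and
      self_mem_nhdsWithin).exists
  replace hε0 : 0 < ε := hε0
  have hp (σ : Finset ι) : ∃ p, σ.Nonempty → (∃ y, ∀ i ∈ σ, infDist y (C i) < ε) →
      ∀ i ∈ σ, p ∈ C i := by
    by_cases h : σ.Nonempty ∧ ∃ y, ∀ i ∈ σ, infDist y (C i) < ε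
    · obtain ⟨z, hz⟩ := hε ⟨σ, h.1⟩ h.2
      exact ⟨z, fun _ _ => hz⟩
    · exact ⟨0, fun h1 h2 => absurd ⟨h1, h2⟩ h⟩
  choose p hp using hp
  let lam (i : ι) (y : E) : ℝ := max 0 (ε - infDist y (C i))
  let w (y : E) (σ : Finset ι) : ℝ :=
    ∏ i ∈ σ, (lam i y * ∏ j ∈ σᶜ, max 0 (lam i y - lam j y))
  let N : Finset (Finset ι) := Finset.univ.filter Finset.Nonempty
  let B : Set E := {y | ∃ i, infDist y (C i) < ε}
  have hlam0 (i y) : 0 ≤ lam i y := le_max_left _ _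
  have hlam_cont (i) : Continuous (lam i) :=
    continuous_const.max (continuous_const.sub (continuous_infDist_pt _))
  have hw0 (y σ) : 0 ≤ w y σ := Finset.prod_nonneg fun i _ =>
    mul_nonneg (hlam0 i y) (Finset.prod_nonneg fun j _ => le_max_left _ _)
  have hw_cont (σ) : Continuous fun y => w y σ := by
    refine continuous_finsetProd _ fun i _ => (hlam_cont i).mul ?_
    exact continuous_finsetProd _ fun j _ =>
      continuous_const.max ((hlam_cont i).sub (hlam_cont j))
  have hlam_pos {i y} (h : 0 < lam i y) : infDist y (C i) < ε := by
    rcases lt_max_iff.1 h with h | h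
    · exact absurd h (lt_irrefl 0)
    · exact sub_pos.1 h
  have hw_lam {y σ} (h : w y σ ≠ 0) {i} (hi : i ∈ σ) : 0 < lam i y :=
    (hlam0 i y).lt_of_ne' (left_ne_zero_of_mul (Finset.prod_ne_zero_iff.1 h i hi))
  have hw_lt {y σ} (h : w y σ ≠ 0) {i j} (hi : i ∈ σ) (hj : j ∉ σ) : lam j y < lam i y := by
    have h1 := right_ne_zero_of_mul (Finset.prod_ne_zero_iff.1 h i hi)
    have h2 := Finset.prod_ne_zero_iff.1 h1 j (Finset.mem_compl.2 hj)
    by_contra h3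
    exact h2 (max_eq_left (by linarith))
  have hsum {y : E} (hy : y ∈ B) : 0 < ∑ σ ∈ N, w y σ := by
    obtain ⟨i, hi⟩ := hy
    obtain ⟨j, -, hj⟩ := Finset.exists_max_image Finset.univ (fun i => lam i y)
      ⟨i, Finset.mem_univ i⟩
    have hj0 : 0 < lam j y :=
      lt_of_lt_of_le (lt_max_of_lt_right (sub_pos.2 hi)) (hj i (Finset.mem_univ i))
    -- The set of all indices with maximal `lam` has positive weight.
    let σ : Finset ι := Finset.univ.filter fun i => lam i y = lam j y
    have hσ : 0 < w y σ := by
      refine Finset.prod_pos fun a ha => ?_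
      have ha' : lam a y = lam j y := (Finset.mem_filter.1 ha).2
      refine mul_pos (ha' ▸ hj0) (Finset.prod_pos fun b hb => lt_max_of_lt_right ?_)
      have hb' : lam b y ≠ lam j y := fun h =>
        Finset.mem_compl.1 hb (Finset.mem_filter.2 ⟨Finset.mem_univ b, h⟩)
      rw [ha', sub_pos]
      exact (hj b (Finset.mem_univ b)).lt_of_ne hb'
    refine Finset.sum_pos' (fun σ _ => hw0 y σ) ⟨σ, ?_, hσ⟩
    exact Finset.mem_filter.2 ⟨Finset.mem_univ σ, j, Finset.mem_filter.2 ⟨Finset.mem_univ j, rfl⟩⟩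
  have hmem {y : E} (hy : y ∈ B) {j : ι} (hj : ∀ i, lam i y ≤ lam j y) :
      N.centerMass (w y) p ∈ C j := by
    rw [← Finset.centerMass_filter_ne_zero]
    refine (hconv j).centerMass_mem (fun σ _ => hw0 y σ) ?_ fun σ hσ => ?_
    · rw [Finset.sum_filter_ne_zero]
      exact hsum hy
    · obtain ⟨hσN, hσw⟩ := Finset.mem_filter.1 hσ
      obtain ⟨i, hi⟩ := (Finset.mem_filter.1 hσN).2
      have hjσ : j ∈ σ := by
        by_contra hjσ
        exact (hj i).not_gt (hw_lt hσw hi hjσ)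
      exact hp σ ⟨i, hi⟩ ⟨y, fun i hi => hlam_pos (hw_lam hσw hi)⟩ j hjσ
  refine ⟨ε / 2, half_pos hε0, B, fun a ha x hax => ?_, ⟨fun y => ⟨N.centerMass (w y) p, ?_⟩, ?_⟩,
    fun y hy => ?_⟩
  · obtain ⟨i, hi⟩ := Set.mem_iUnion.1 ha
    refine ⟨i, (infDist_le_dist_of_mem hi).trans_lt ?_⟩
    rw [dist_comm]
    linarith
  · obtain ⟨i, hi⟩ := y.2
    obtain ⟨j, -, hj⟩ := Finset.exists_max_image Finset.univ (fun i => lam i y)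
      ⟨i, Finset.mem_univ i⟩
    exact Set.mem_iUnion.2 ⟨j, hmem y.2 fun i => hj i (Finset.mem_univ i)⟩
  · refine Continuous.subtype_mk ?_ _
    have h1 (σ) : Continuous fun y : B => w y σ := (hw_cont σ).comp continuous_subtype_val
    exact ((continuous_finsetSum _ fun σ _ => h1 σ).inv₀ fun y => (hsum y.2).ne').smul
      (continuous_finsetSum _ fun σ _ => (h1 σ).smul continuous_const)
  · obtain ⟨j, hj⟩ := Set.mem_iUnion.1 hy
    have hmax (i) : lam i y ≤ lam j y := by
      have : lam j y = ε := by
        simp [lam, infDist_zero_of_mem hj, hε0.le]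
      rw [this]
      exact max_le hε0.le (sub_le_self _ infDist_nonneg)
    exact ((hconv j).segment_subset hj (hmem y.2 hmax)).trans (Set.subset_iUnion C j)

/-- A finite union of compact convex sets has finite-dimensional singular homology. -/
theorem finiteDimensional_homology_iUnion_convex (k : Type u) [Field k] (n : ℕ) {C : ι → Set E}
    (hC : ∀ i, IsCompact (C i)) (hconv : ∀ i, Convex ℝ (C i)) (hne : ∀ i, (C i).Nonempty) :
    FiniteDimensional k (SSet.homology (TopCat.toSSet.obj (TopCat.of (⋃ i, C i)))
      (ModuleCat.of k k) n : ModuleCat.{u} k) := by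
  obtain ⟨δ, hδ, B, hB, f, hf⟩ := exists_neighborhood_map_of_iUnion_convex hC hconv hne
  have hKB : ⋃ i, C i ⊆ B := fun a ha => hB a ha a (by simpa using hδ.le)
  have hrank := finiteDimensional_range_homologyMap_inclusion k n
    (isCompact_iUnion hC).totallyBounded hδ hB hKB
  let F : TopCat.of B ⟶ TopCat.of (⋃ i, C i) := TopCat.ofHom f
  obtain ⟨H⟩ := nonempty_homotopy_of_segment_subset
    (𝟙 (TopCat.toSSet.obj (TopCat.of (⋃ i, C i))))
    (TopCat.toSSet.map (inclusionHom hKB) ≫ TopCat.toSSet.map F)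
    fun m σ t => by
      let a : ⋃ i, C i := TopCat.toSSetObjEquiv (TopCat.of (⋃ i, C i)) m σ t
      exact hf ⟨a, hKB a.2⟩ a.2
  have key := H.congr_homologyMap (ModuleCat.of k k) n
  rw [SSet.homologyMap_comp, SSet.homologyMap_id] at key
  -- The identity of the homology of the union factors through a range of finite dimension.
  refine Module.Finite.of_surjective ((SSet.homologyMap (TopCat.toSSet.map F) (ModuleCat.of k k)
    n).hom ∘ₗ (LinearMap.range (SSet.homologyMap (TopCat.toSSet.map (inclusionHom hKB))
      (ModuleCat.of k k) n).hom).subtype) fun x => ⟨⟨_, x, rfl⟩, ?_⟩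
  exact (congrArg (fun φ => φ.hom x) key).symm

end ConvexUnion
end

noncomputable section

open Opposite SSet

/-! ### The weighted Čech filtration -/

namespace WeightedCech

/-- Between the times `s` and `s + δ` the balls grow at least by `δ`: this is Minkowski's inequality
for the vectors `(r, w)` and `(δ, 0)`, where `r` is the radius at time `s`. -/
theorem radius_add_le {p : ℝ≥0∞} (hp : 1 ≤ p) (w s δ a : ℝ≥0)
    (ha : (a : WithBot ℝ≥0) ≤ radius p w s) :
    ((a + δ : ℝ≥0) : WithBot ℝ≥0) ≤ radius p w (s + δ) := by
  unfold radius at ha ⊢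
  by_cases hs : s < w
  · simp [hs] at ha
  have hs' : w ≤ s := not_lt.1 hs
  have ht : ¬ s + δ < w := fun h => hs (lt_of_le_of_lt le_self_add h)
  by_cases hp' : p = ∞
  · simp only [hs, ht, hp', if_false, if_true] at ha ⊢
    exact WithBot.coe_le_coe.2 (add_le_add_left (WithBot.coe_le_coe.1 ha) δ)
  simp only [hs, ht, hp', if_false] at ha ⊢
  have hq : 1 ≤ p.toReal := by simpa using ENNReal.toReal_mono hp' hp
  have hq0 : 0 < p.toReal := by linarith
  set q := p.toReal
  have ha' : a ^ q ≤ s ^ q - w ^ q := by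
    have := NNReal.rpow_le_rpow (WithBot.coe_le_coe.1 ha) hq0.le
    rwa [← NNReal.rpow_mul, one_div_mul_cancel hq0.ne', NNReal.rpow_one] at this
  have haw : a ^ q + w ^ q ≤ s ^ q :=
    (le_tsub_iff_right (NNReal.rpow_le_rpow hs' hq0.le)).1 ha'
  have hmink := NNReal.Lp_add_le Finset.univ ![a, w] ![δ, 0] hq
  simp only [Fin.sum_univ_two, Matrix.cons_val_zero, Matrix.cons_val_one, add_zero,
    NNReal.zero_rpow hq0.ne'] at hmink
  rw [← NNReal.rpow_mul δ, mul_one_div_cancel hq0.ne', NNReal.rpow_one] at hmink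
  have h1 : ((a + δ) ^ q + w ^ q) ^ (1 / q) ≤ s + δ := by
    refine hmink.trans (add_le_add_left ?_ δ)
    have := NNReal.rpow_le_rpow haw (one_div_nonneg.2 hq0.le)
    rwa [← NNReal.rpow_mul s, mul_one_div_cancel hq0.ne', NNReal.rpow_one] at this
  have h2 : (a + δ) ^ q + w ^ q ≤ (s + δ) ^ q := by
    have := NNReal.rpow_le_rpow h1 hq0.le
    rwa [← NNReal.rpow_mul, one_div_mul_cancel hq0.ne', NNReal.rpow_one] at this
  refine WithBot.coe_le_coe.2 ?_
  have h3 := NNReal.rpow_le_rpow (le_tsub_of_add_le_right h2) (one_div_nonneg.2 hq0.le)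
  rwa [← NNReal.rpow_mul, mul_one_div_cancel hq0.ne', NNReal.rpow_one] at h3

theorem radius_ne_bot (p : ℝ≥0∞) {w t : ℝ≥0} (h : w ≤ t) : radius p w t ≠ ⊥ := by
  unfold radius
  rw [if_neg h.not_gt]
  split_ifs <;> exact WithBot.coe_ne_bot

/-- The radius at time `s` is at most `s`, stated so that it covers the radius `-∞`. -/
theorem radius_le {p : ℝ≥0∞} (hp : 1 ≤ p) (w s a : ℝ≥0) (ha : (a : WithBot ℝ≥0) ≤ radius p w s) :
    a ≤ s := by
  unfold radius at ha
  by_cases hs : s < w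
  · simp [hs] at ha
  by_cases hp' : p = ∞
  · simp only [hs, hp', if_false, if_true] at ha
    exact WithBot.coe_le_coe.1 ha
  simp only [hs, hp', if_false] at ha
  have hq : 1 ≤ p.toReal := by simpa using ENNReal.toReal_mono hp' hp
  have hq0 : 0 < p.toReal := by linarith
  have h1 := NNReal.rpow_le_rpow (tsub_le_self : s ^ p.toReal - w ^ p.toReal ≤ s ^ p.toReal)
    (one_div_nonneg.2 hq0.le)
  rw [← NNReal.rpow_mul s, mul_one_div_cancel hq0.ne', NNReal.rpow_one] at h1
  exact (WithBot.coe_le_coe.1 ha).trans h1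

theorem mem_sublevel_of_dist_le {E : Type*} [PseudoMetricSpace E] {p : ℝ≥0∞} (hp : 1 ≤ p)
    {X : Set E} {f : X → ℝ≥0} {s t : ℝ≥0} (hst : s ≤ t) {y z : E} (hy : y ∈ sublevel p X f s)
    (hyz : dist y z ≤ t - s) : z ∈ sublevel p X f t := by
  obtain ⟨x, hx⟩ := Set.mem_iUnion.1 hy
  refine Set.mem_iUnion.2 ⟨x, ?_⟩
  have h1 := radius_add_le hp (f x) s (t - s) _ hx
  rw [add_tsub_cancel_of_le hst] at h1
  refine le_trans (WithBot.coe_le_coe.2 ?_) h1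
  refine (nndist_triangle z y x).trans ?_
  rw [add_comm]
  refine add_le_add_right ?_ _
  rw [nndist_comm, ← NNReal.coe_le_coe, coe_nndist, NNReal.coe_sub hst]
  exact hyz

theorem isBounded_sublevel {E : Type*} [PseudoMetricSpace E] {p : ℝ≥0∞} (hp : 1 ≤ p)
    {X : Set E} (hX : Bornology.IsBounded X) (f : X → ℝ≥0) (t : ℝ≥0) :
    Bornology.IsBounded (sublevel p X f t) := by
  refine (hX.cthickening (δ := t)).subset fun y hy => ?_
  obtain ⟨x, hx⟩ := Set.mem_iUnion.1 hy
  refine Metric.mem_cthickening_of_dist_le y x t X x.2 ?_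
  exact_mod_cast radius_le hp _ _ _ hx

/-- Only the points whose weight is at most `t` contribute to the sublevel set at time `t`. -/
theorem sublevel_eq_iUnion {E : Type*} [PseudoMetricSpace E] (p : ℝ≥0∞) (X : Set E) (f : X → ℝ≥0)
    (t : ℝ≥0) : sublevel p X f t = ⋃ x : {x : X // f x ≤ t},
      Metric.closedBall (x.1 : E) ((radius p (f x.1) t).unbotD 0 : ℝ≥0) := by
  ext y
  simp only [sublevel, Set.mem_iUnion]
  constructor
  · rintro ⟨x, hx⟩
    have hxt : f x ≤ t := by
      by_contra h
      simp [ball, radius, not_le.1 h] at hx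
    refine ⟨⟨x, hxt⟩, ?_⟩
    change (nndist y x : WithBot ℝ≥0) ≤ _ at hx
    obtain ⟨r, hr⟩ := WithBot.ne_bot_iff_exists.1 (radius_ne_bot p hxt)
    rw [← hr] at hx
    rw [← hr]
    exact WithBot.coe_le_coe.1 hx
  · rintro ⟨⟨x, hxt⟩, hx⟩
    refine ⟨x, ?_⟩
    change (nndist y x : WithBot ℝ≥0) ≤ _
    obtain ⟨r, hr⟩ := WithBot.ne_bot_iff_exists.1 (radius_ne_bot p hxt)
    rw [← hr] at hx ⊢
    exact WithBot.coe_le_coe.2 hx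

end WeightedCech

end

theorem mainTheorem12 (k : Type u) [Field k] (d : ℕ) (p : ℝ≥0∞) (hp : 1 ≤ p)
    (X : Set (EuclideanSpace ℝ (Fin d))) (f : X → ℝ≥0) :
    (X.Finite → ∀ n : ℕ,
      (WeightedCech.persistence k n p X f).IsPointwiseFiniteDimensional) ∧
    (Bornology.IsBounded X → ∀ n : ℕ,
      (WeightedCech.persistence k n p X f).IsQTame) := by
  refine ⟨fun hX n t => ?_, fun hX n s t hst => ?_⟩
  · have : Finite X := hX
    change FiniteDimensional k (SSet.homology (TopCat.toSSet.obj
      (TopCat.of (WeightedCech.sublevel p X f t))) (ModuleCat.of k k) n : ModuleCat.{u} k)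
    rw [WeightedCech.sublevel_eq_iUnion]
    exact finiteDimensional_homology_iUnion_convex k n (fun x => isCompact_closedBall _ _)
      (fun x => convex_closedBall _ _) fun x => Metric.nonempty_closedBall.2 (NNReal.coe_nonneg _)
  · have hbdd := WeightedCech.isBounded_sublevel hp hX f s
    exact finiteDimensional_range_homologyMap_inclusion k n
      (hbdd.isCompact_closure.totallyBounded.subset subset_closure)
      (sub_pos.2 (NNReal.coe_lt_coe.2 hst))
      (fun a ha x hx => WeightedCech.mem_sublevel_of_dist_le hp hst.le ha hx)
      (WeightedCech.sublevel_mono p X f hst.le)
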